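/- Let $d\ge 2$, $T\ge 1$ be integers, $s\ge 0$, and let $x_1,\dots,x_T\in[0,s]^d$ be a fixed sequence of loss vectors. For $f$ in the open simplex $\{f\in\mathbb{R}^{d-1}: f[i]>0 \text{ for all } i,\ \sum_{i=1}^{d-1}f[i]<1\}$ let $$\mathcal R(f)=-\sum_{i=1}^{d-1}\log f[i]-\log\Bigl(1-\sum_{i=1}^{d-1}f[i]\Bigr),$$ and $\mathcal R=+\infty$ elsewhere. Given $\eta>0$, SCRiBLe for multi-armed bandits starts with $h_1=(1/d,\dots,1/d)\in\mathbb{R}^{d-1}$ and at each round $t=1,\dots,T$: 1. takes an orthonormal basis $v_1,\dots,v_{d-1}$ of eigenvectors of $\nabla^2\mathcal R(h_t)$, with eigenvalues $\lambda_1,\dots,\lambda_{d-1}$ (any choice, which may depend on the past); 2. draws, independently of each other and of the past, $i_t$ uniformly from $\{1,\dots,d-1\}$ and $\varepsilon_t$ uniformly from $\{-1,1\}$, and puts $f_t=h_t+\varepsilon_t\lambda_{i_t}^{-1/2}v_{i_t}$ and $q_t=\bigl(f_t,\,1-\sum_{i=1}^{d-1}f_t[i]\bigr)$, which is a probability vector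 on the $d$ arms; 3. draws an arm $j_t\sim q_t$ (conditionally on the past, $i_t$ and $\varepsilon_t$), suffers and observes the loss $x_t[j_t]$, and puts $\tilde x_t=d\,x_t[j_t]\,\varepsilon_t\lambda_{i_t}^{1/2}v_{i_t}$; 4. puts $h_{t+1}=\arg\min_{h\in\mathbb{R}^{d-1}}\bigl[\eta\bigl\langle h,\sum_{r=1}^{t}\tilde x_r\bigr\rangle+\mathcal R(h)\bigr]$. If $4\eta s d^2<1$ (that is, $\eta<1/(4sd^2)$ when $s>0$), then $$\mathbb E\Bigl[\sum_{t=1}^T x_t[j_t]\Bigr]\le\frac{1}{1-4\eta s d^2}\Bigl(\min_{1\le j\le d}\sum_{t=1}^T x_t[j]+d\,\eta^{-1}\log(dT)\Bigr).$$ -/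

import Mathlib

open MeasureTheory

namespace Scrible

/-- `ℝ^(d-1)` with the Euclidean inner product, where `d = n + 1` is the number of arms: a point
lists the first `d - 1` coordinates of a vector in `ℝ^d` whose coordinates sum to one. -/
abbrev Pt (n : ℕ) : Type := EuclideanSpace ℝ (Fin n)

/-- `q = (f, 1 - ∑ i, f i)`, the vector indexed by the `d = n + 1` arms. -/
noncomputable def lift {n : ℕ} (f : Pt n) : Fin (n + 1) → ℝ :=
  Fin.snoc (α := fun _ => ℝ) (fun i => f i) (1 - ∑ i, f i)

/-- The open simplex in `ℝ^(d-1)`; the domain of the log-barrier (outside of it the barrier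
is `+∞`). -/
def openSimplex (n : ℕ) : Set (Pt n) := {f | (∀ i, 0 < f i) ∧ ∑ i, f i < 1}

/-- The log-barrier `R(f) = - ∑ i, log f i - log (1 - ∑ i, f i)`, to be used on `openSimplex n`. -/
noncomputable def barrier {n : ℕ} (f : Pt n) : ℝ :=
  - ∑ i, Real.log (f i) - Real.log (1 - ∑ i, f i)

/-- The Hessian `∇²R(h)`, as the derivative of the gradient. -/
noncomputable def hessian {n : ℕ} (R : Pt n → ℝ) (h : Pt n) : Pt n →L[ℝ] Pt n :=
  fderiv ℝ (gradient R) h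

/-- The regularized cumulative linear loss `η ⟨h, S⟩ + R(h)`. -/
noncomputable def objective {n : ℕ} (η : ℝ) (S h : Pt n) : ℝ := η * inner ℝ h S + barrier h

theorem uniform_mem_openSimplex (n : ℕ) :
    (WithLp.toLp 2 (fun _ => 1 / ((n : ℝ) + 1)) : Pt n) ∈ openSimplex n := by
  have hn : (0 : ℝ) < (n : ℝ) + 1 := by positivity
  refine ⟨fun i => by simpa using hn, ?_⟩
  simp only [Finset.sum_const, Finset.card_univ, Fintype.card_fin, nsmul_eq_mul]
  rw [mul_one_div, div_lt_one hn]
  linarith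

/-- The regularized loss has a minimizer over the domain of the barrier. -/
theorem exists_argmin {n : ℕ} (η : ℝ) (S : Pt n) :
    ∃ h ∈ openSimplex n, IsMinOn (objective η S) (openSimplex n) h := by
  let G : Pt n → ℝ := fun f =>
    (∏ i, f i) * (1 - ∑ i, f i) * Real.exp (-(η * inner ℝ f S))
  have hG : Continuous G := by fun_prop
  let K : Set (Pt n) := {f | (∀ i, 0 ≤ f i) ∧ ∑ i, f i ≤ 1}
  have hKsub : K ⊆ (WithLp.toLp 2) '' (Set.univ.pi fun _ : Fin n => Set.Icc (0 : ℝ) 1) := by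
    intro f hf
    refine ⟨WithLp.ofLp f, fun i _ => ⟨hf.1 i, ?_⟩, rfl⟩
    exact (Finset.single_le_sum (f := fun i => f i) (fun j _ => hf.1 j)
      (Finset.mem_univ i)).trans hf.2
  have hKcl : IsClosed K := by
    have h1 : IsClosed {f : Pt n | ∀ i, 0 ≤ f i} := by
      have : {f : Pt n | ∀ i, 0 ≤ f i} = ⋂ i, {f : Pt n | 0 ≤ f i} := by ext; simp
      rw [this]
      exact isClosed_iInter fun i =>
        isClosed_le continuous_const (by fun_prop : Continuous fun f : Pt n => f i)
    exact h1.inter (isClosed_le (by fun_prop : Continuous fun f : Pt n => ∑ i, f i) continuous_const)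
  have hK : IsCompact K :=
    ((isCompact_univ_pi fun _ => isCompact_Icc).image
      (PiLp.continuous_toLp 2 _)).of_isClosed_subset hKcl hKsub
  have hsub : openSimplex n ⊆ K := fun f hf => ⟨fun i => (hf.1 i).le, hf.2.le⟩
  obtain ⟨h, hhK, hmax⟩ :=
    hK.exists_isMaxOn ⟨_, hsub (uniform_mem_openSimplex n)⟩ hG.continuousOn
  have hGpos : ∀ f ∈ openSimplex n, 0 < G f := fun f hf =>
    mul_pos (mul_pos (Finset.prod_pos fun i _ => hf.1 i) (sub_pos.2 hf.2)) (Real.exp_pos _)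
  have hGh : 0 < G h :=
    (hGpos _ (uniform_mem_openSimplex n)).trans_le (hmax (hsub (uniform_mem_openSimplex n)))
  have hmem : h ∈ openSimplex n := by
    constructor
    · intro i
      refine lt_of_le_of_ne (hhK.1 i) fun h0 => hGh.ne' ?_
      have : ∏ i, h i = 0 := Finset.prod_eq_zero (Finset.mem_univ i) h0.symm
      simp [G, this]
    · refine lt_of_le_of_ne hhK.2 fun h0 => hGh.ne' ?_
      simp [G, h0]
  have hlog : ∀ f ∈ openSimplex n, objective η S f = - Real.log (G f) := by
    intro f hf
    have h1 : ∏ i, f i ≠ 0 := (Finset.prod_pos fun i _ => hf.1 i).ne'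
    have h2 : 1 - ∑ i, f i ≠ 0 := (sub_pos.2 hf.2).ne'
    simp only [G, objective, barrier]
    rw [Real.log_mul (mul_ne_zero h1 h2) (Real.exp_pos _).ne', Real.log_mul h1 h2,
      Real.log_exp, Real.log_prod fun i _ => (hf.1 i).ne']
    ring
  refine ⟨h, hmem, fun f hf => ?_⟩
  change objective η S h ≤ objective η S f
  rw [hlog h hmem, hlog f hf]
  exact neg_le_neg (Real.log_le_log (hGpos f hf) (hmax (hsub hf)))

/-- `argmin_h [η ⟨h, S⟩ + R(h)]` (unique, as the barrier is strictly convex). -/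
noncomputable def leader {n : ℕ} (η : ℝ) (S : Pt n) : Pt n := (exists_argmin η S).choose

/-- The centre `h_t`, given the sum `S` of the estimates of the preceding rounds: uniform weights
in the first round, the regularized leader afterwards. -/
noncomputable def center {n : ℕ} (η : ℝ) : ℕ → Pt n → Pt n
  | 0, _ => WithLp.toLp 2 (fun _ => 1 / ((n : ℝ) + 1))
  | _ + 1, S => leader η S

theorem center_mem {n : ℕ} (η : ℝ) (t : ℕ) (S : Pt n) : center η t S ∈ openSimplex n := by
  cases t with
  | zero => exact uniform_mem_openSimplex n
  | succ t => exact (exists_argmin η S).choose_spec.1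

/-- The random choices of one round: the index `i_t` of an eigenvector, the sign `ε_t`
(`true` for `+1`) and the arm `j_t`. -/
abbrev Round (n : ℕ) : Type := Fin n × Bool × Fin (n + 1)

/-- The sign `±1` encoded by a Boolean. -/
def sgn (b : Bool) : ℝ := if b then 1 else -1

/-- A rule that picks, given the number and the outcomes of the past rounds and the current centre
`h`, an orthonormal basis of eigenvectors of `∇²R(h)` together with their eigenvalues. -/
structure EigenRule (n : ℕ) where
  vec : (t : ℕ) → (Fin t → Round n) → Pt n → OrthonormalBasis (Fin n) ℝ (Pt n)
  val : (t : ℕ) → (Fin t → Round n) → Pt n → Fin n → ℝ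
  eigen : ∀ t past h, h ∈ openSimplex n → ∀ i,
    hessian barrier h (vec t past h i) = val t past h i • vec t past h i

theorem gradient_barrier {n : ℕ} {h : Pt n} (hh : h ∈ openSimplex n) :
    gradient barrier h = WithLp.toLp 2 (fun i => - (h i)⁻¹ + (1 - ∑ k, h k)⁻¹) := by
  apply HasGradientAt.gradient
  rw [hasGradientAt_iff_hasFDerivAt]
  have hp : ∀ i, HasFDerivAt (fun f : Pt n => f i)
      (EuclideanSpace.proj i : Pt n →L[ℝ] ℝ) h := fun i =>
    (EuclideanSpace.proj i : Pt n →L[ℝ] ℝ).hasFDerivAt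
  have h1 := (HasFDerivAt.fun_sum (u := Finset.univ) fun i _ => (hp i).log (hh.1 i).ne').neg
  have h2 := ((HasFDerivAt.fun_sum (u := Finset.univ) fun i _ => hp i).const_sub 1).log
    (sub_pos.2 hh.2).ne'
  refine (h1.sub h2).congr_fderiv ?_
  ext v
  have h3 : ∑ k, (-(h k)⁻¹ + (1 - ∑ k, h k)⁻¹) * v k =
      -∑ k, (h k)⁻¹ * v k + (∑ k, v k) * (1 - ∑ k, h k)⁻¹ := by
    simp only [add_mul, Finset.sum_add_distrib, neg_mul, Finset.sum_neg_distrib,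
      ← Finset.mul_sum, mul_comm]
  simp [PiLp.inner_apply, h3, mul_comm]

theorem isOpen_openSimplex (n : ℕ) : IsOpen (openSimplex n) := by
  have h1 : IsOpen {f : Pt n | ∀ i, 0 < f i} := by
    have : {f : Pt n | ∀ i, 0 < f i} = ⋂ i, {f : Pt n | 0 < f i} := by ext; simp
    rw [this]
    exact isOpen_iInter_of_finite fun i =>
      isOpen_lt continuous_const (by fun_prop : Continuous fun f : Pt n => f i)
  exact h1.inter (isOpen_lt (by fun_prop : Continuous fun f : Pt n => ∑ i, f i) continuous_const)

theorem hessian_barrier {n : ℕ} {h : Pt n} (hh : h ∈ openSimplex n) (v : Pt n) (i : Fin n) :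
    hessian barrier h v i = v i / h i ^ 2 + (∑ k, v k) / (1 - ∑ k, h k) ^ 2 := by
  have hev : gradient barrier =ᶠ[nhds h]
      fun f : Pt n => WithLp.toLp 2 (fun i => - (f i)⁻¹ + (1 - ∑ k, f k)⁻¹) :=
    Filter.eventuallyEq_of_mem ((isOpen_openSimplex n).mem_nhds hh)
      fun f hf => gradient_barrier hf
  have hp : ∀ i, HasFDerivAt (fun f : Pt n => f i)
      (EuclideanSpace.proj i : Pt n →L[ℝ] ℝ) h := fun i =>
    (EuclideanSpace.proj i : Pt n →L[ℝ] ℝ).hasFDerivAt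
  have h1 := fun i => ((hasDerivAt_inv (hh.1 i).ne').comp_hasFDerivAt h (hp i)).neg
  have h2 := (hasDerivAt_inv (sub_pos.2 hh.2).ne').comp_hasFDerivAt h
    ((HasFDerivAt.fun_sum (u := Finset.univ) fun i _ => hp i).const_sub 1)
  have hd : DifferentiableAt ℝ
      (fun f : Pt n => (WithLp.toLp 2 (fun i => - (f i)⁻¹ + (1 - ∑ k, f k)⁻¹) : Pt n)) h := by
    rw [differentiableAt_euclidean]
    exact fun i => ((h1 i).add h2).differentiableAt
  have hd' := ((EuclideanSpace.proj i : Pt n →L[ℝ] ℝ).hasFDerivAt.comp h hd.hasFDerivAt).unique ((h1 i).add h2)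
  have := DFunLike.congr_fun hd' v
  rw [hessian, hev.fderiv_eq]
  simp only [ContinuousLinearMap.comp_apply, PiLp.proj_apply] at this
  rw [this]
  simp [div_eq_mul_inv, mul_comm]

/-- Such rules exist, by the spectral theorem. -/
instance (n : ℕ) : Nonempty (EigenRule n) := by
  have hsym : ∀ h : Pt n, h ∈ openSimplex n → (hessian barrier h).toLinearMap.IsSymmetric := by
    intro h hh v w
    simp only [PiLp.inner_apply, ContinuousLinearMap.coe_coe, hessian_barrier hh, RCLike.inner_apply, conj_trivial,
      mul_add, add_mul, Finset.sum_add_distrib, ← Finset.sum_mul, ← Finset.mul_sum]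
    congr 1
    · exact Finset.sum_congr rfl fun i _ => by ring
    · ring
  classical
  exact ⟨{
    vec := fun _ _ h => if hh : h ∈ openSimplex n then (hsym h hh).eigenvectorBasis (by simp)
      else EuclideanSpace.basisFun _ _
    val := fun _ _ h => if hh : h ∈ openSimplex n then
      (hsym h hh).eigenvalues (n := n) (by simp) else 0
    eigen := fun _ _ h hh i => by
      simp only [dif_pos hh]
      exact (hsym h hh).apply_eigenvectorBasis (by simp) i }⟩

/-- A step of length `λ^(-1/2)` along a unit eigenvector of `∇²R(h)` stays in the simplex. -/
theorem lift_step_nonneg {n : ℕ} {h : Pt n} (hh : h ∈ openSimplex n) {v : Pt n} {l : ℝ}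
    (hv : ‖v‖ = 1) (hl : hessian barrier h v = l • v) (b : Bool) (j : Fin (n + 1)) :
    0 ≤ lift (h + (sgn b * (Real.sqrt l)⁻¹) • v) j := by
  have hpos : 0 < 1 - ∑ k, h k := sub_pos.2 hh.2
  have hsq : ∑ i, v i * v i = 1 := by
    have := EuclideanSpace.real_norm_sq_eq v
    rw [hv] at this
    simpa [sq] using this.symm
  have hlam : l = ∑ i, (v i / h i) ^ 2 + ((∑ k, v k) / (1 - ∑ k, h k)) ^ 2 := by
    calc l = ∑ i, v i * (l • v) i := by
          simp only [PiLp.smul_apply, smul_eq_mul]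
          calc l = l * ∑ i, v i * v i := by rw [hsq, mul_one]
            _ = _ := by
              rw [Finset.mul_sum]
              exact Finset.sum_congr rfl fun i _ => by ring
      _ = _ := by
          rw [← hl]
          simp only [hessian_barrier hh, mul_add, Finset.sum_add_distrib, ← Finset.sum_mul]
          congr 1
          · exact Finset.sum_congr rfl fun i _ => by ring
          · rw [div_pow, sq (∑ k, v k), mul_div_assoc]
  have key : ∀ a c : ℝ, 0 < c → (a / c) ^ 2 ≤ l → |sgn b * (Real.sqrt l)⁻¹ * a| ≤ c := by
    intro a c hc hac
    have hs : |sgn b| = 1 := by cases b <;> simp [sgn]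
    rw [abs_mul, abs_mul, hs, one_mul, abs_of_nonneg (inv_nonneg.2 (Real.sqrt_nonneg l))]
    have h1 : |a| ≤ c * Real.sqrt l := by
      have := Real.abs_le_sqrt hac
      rw [abs_div, abs_of_pos hc, div_le_iff₀ hc] at this
      linarith
    rcases (Real.sqrt_nonneg l).eq_or_lt with h0 | h0
    · simp [← h0, hc.le]
    · rw [inv_mul_le_iff₀ h0]
      linarith
  have hS : 0 ≤ ∑ i, (v i / h i) ^ 2 := Finset.sum_nonneg fun i _ => sq_nonneg _
  refine Fin.lastCases ?_ (fun i => ?_) j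
  · have := key (∑ k, v k) _ hpos (by rw [hlam]; linarith)
    simp only [lift, Fin.snoc_last, PiLp.add_apply, PiLp.smul_apply, smul_eq_mul,
      Finset.sum_add_distrib, ← Finset.mul_sum]
    linarith [(abs_le.1 this).2]
  · have := key (v i) _ (hh.1 i) (by
      rw [hlam]
      have h3 := Finset.single_le_sum (f := fun i => (v i / h i) ^ 2)
        (fun j _ => sq_nonneg _) (Finset.mem_univ i)
      have h4 := sq_nonneg ((∑ k, v k) / (1 - ∑ k, h k))
      linarith)
    simp only [lift, Fin.snoc_castSucc, PiLp.add_apply, PiLp.smul_apply, smul_eq_mul]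
    linarith [(abs_le.1 this).1]

theorem sum_lift {n : ℕ} (f : Pt n) : ∑ j, lift f j = 1 := by
  simp [lift, Fin.sum_univ_castSucc]

section Algorithm

variable {n : ℕ} (η : ℝ) (x : ℕ → Fin (n + 1) → ℝ) (E : EigenRule n)

/-- The estimate `x̃_t = d ⟨e_{j_t}, x_t⟩ ε_t λ_{i_t}^{1/2} v_{i_t}` with `d = n + 1`, from the
outcomes of the past rounds, the centre `h` and the outcome `r = (i_t, ε_t, j_t)`. -/
noncomputable def estimate (t : ℕ) (past : Fin t → Round n) (h : Pt n) (r : Round n) : Pt n :=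
  (((n : ℝ) + 1) * x t r.2.2 * sgn r.2.1 * Real.sqrt (E.val t past h r.1)) • E.vec t past h r.1

/-- The sum of the estimates of the first `t` rounds. -/
noncomputable def cumEstimate : (t : ℕ) → (Fin t → Round n) → Pt n
  | 0, _ => 0
  | t + 1, past =>
    cumEstimate t (Fin.init past) +
      estimate x E t (Fin.init past) (center η t (cumEstimate t (Fin.init past)))
        (past (Fin.last t))

/-- The centre `h_t` after the past rounds. -/
noncomputable def centerAt (t : ℕ) (past : Fin t → Round n) : Pt n :=
  center η t (cumEstimate η x E t past)

/-- The point `f_t = h_t + ε_t λ_{i_t}^{-1/2} v_{i_t}`. -/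
noncomputable def play (t : ℕ) (past : Fin t → Round n) (i : Fin n) (b : Bool) : Pt n :=
  let h := centerAt η x E t past
  h + (sgn b * (Real.sqrt (E.val t past h i))⁻¹) • E.vec t past h i

theorem lift_play_nonneg (t : ℕ) (past : Fin t → Round n) (i : Fin n) (b : Bool)
    (j : Fin (n + 1)) : 0 ≤ lift (play η x E t past i b) j :=
  lift_step_nonneg (center_mem _ _ _) ((E.vec t past _).norm_eq_one i)
    (E.eigen t past _ (center_mem _ _ _) i) b j

/-- The law `q_t = (f_t, 1 - ∑ i, f_t i)` of the arm. -/
noncomputable def armLaw (t : ℕ) (past : Fin t → Round n) (i : Fin n) (b : Bool) :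
    PMF (Fin (n + 1)) :=
  PMF.ofFintype (fun j => ENNReal.ofReal (lift (play η x E t past i b) j)) (by
    rw [← ENNReal.ofReal_sum_of_nonneg fun j _ => lift_play_nonneg η x E t past i b j,
      sum_lift, ENNReal.ofReal_one])

/-- The law of `(i_t, ε_t, j_t)` given the past: `i_t` and `ε_t` are uniform and independent, and
then `j_t ∼ q_t`. -/
noncomputable def roundLaw [NeZero n] (t : ℕ) (past : Fin t → Round n) : PMF (Round n) :=
  (PMF.uniformOfFintype (Fin n)).bind fun i =>
    (PMF.uniformOfFintype Bool).bind fun b =>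
      (armLaw η x E t past i b).map fun j => (i, b, j)

/-- The law of the outcomes of the first `T` rounds of SCRiBLe for multi-armed bandits with
learning rate `η` against the loss sequence `x`. Rounds are numbered from `0`. -/
noncomputable def scribleLaw [NeZero n] : (T : ℕ) → PMF (Fin T → Round n)
  | 0 => PMF.pure Fin.elim0
  | T + 1 => (scribleLaw T).bind fun past =>
      (roundLaw η x E T past).map fun r => Fin.snoc (α := fun _ => Round n) past r

end Algorithm

end Scrible

open Scrible

namespace Scrible

/-! The proof follows a potential: the regularized estimated loss at the current centre, minus `η`
times the estimated loss of a comparator `u`. It starts at `d log d`, the barrier at the uniform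
point, and, the centre then being a minimizer, ends at most at `barrier u` (`potential_le`).

In between, a round raises it by at least `η ⟨h_t - u, x̃_t⟩ - 2 (η d x_t[j_t])²`
(`potential_snoc_ge`). This rests on `objective_perturb_ge`, which sums tangent-line bounds for
`-log` over the `d` coordinates, the quadratic errors adding up exactly because `v` is an
eigenvector. The new centre may be anywhere in the simplex, so its distance to the old one is never
estimated.

Averaged over the round, the linear term becomes `η d/(d-1)` times the expected regret against `u`.
As `0 ≤ x ≤ s`, one factor of the quadratic term is bounded by `s` and the other stays, so the error
is a multiple of the learner's own expected loss `L`. Moving it to the left gives the factor in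
front of the bound.

Finally `u` is the best arm mixed with weight `1/T` of the uniform law: its barrier is at most `d
log (dT)` and it loses at most `s` more than the best arm. -/

/-- The expectation of a real function under a probability mass function on a finite type. -/
noncomputable def expect {α : Type*} [Fintype α] (p : PMF α) (F : α → ℝ) : ℝ :=
  ∑ a, (p a).toReal * F a

/-! ### Expectations on finite types. -/

section Expectation

variable {α β : Type*} [Fintype α] [Fintype β]

theorem expect_bind (p : PMF α) (f : α → PMF β) (F : β → ℝ) :
    expect (p.bind f) F = expect p fun a => expect (f a) F := by
  simp only [expect, PMF.bind_apply, tsum_fintype, Finset.mul_sum]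
  rw [Finset.sum_comm]
  refine Finset.sum_congr rfl fun b _ => ?_
  rw [ENNReal.toReal_sum fun a _ => ENNReal.mul_ne_top (p.apply_ne_top a) ((f a).apply_ne_top b),
    Finset.sum_mul]
  exact Finset.sum_congr rfl fun a _ => by rw [ENNReal.toReal_mul, mul_assoc]

theorem expect_pure (a : α) (F : α → ℝ) : expect (PMF.pure a) F = F a := by
  classical
  simp [expect, PMF.pure_apply, apply_ite ENNReal.toReal]

theorem expect_map (p : PMF α) (f : α → β) (F : β → ℝ) :
    expect (p.map f) F = expect p fun a => F (f a) := by
  simp only [PMF.map, expect_bind, Function.comp_apply, expect_pure]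

theorem sum_toReal_apply (p : PMF α) : ∑ a, (p a).toReal = 1 := by
  rw [← ENNReal.toReal_sum fun a _ => p.apply_ne_top a, ← tsum_fintype (L := .unconditional α), p.tsum_coe,
    ENNReal.toReal_one]

theorem expect_const (p : PMF α) (c : ℝ) : expect p (fun _ => c) = c := by
  rw [expect, ← Finset.sum_mul, sum_toReal_apply, one_mul]

theorem expect_add (p : PMF α) (F G : α → ℝ) :
    expect p (fun a => F a + G a) = expect p F + expect p G := by
  simp only [expect, mul_add, Finset.sum_add_distrib]

theorem expect_const_mul (p : PMF α) (c : ℝ) (F : α → ℝ) :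
    expect p (fun a => c * F a) = c * expect p F := by
  simp only [expect, Finset.mul_sum]
  exact Finset.sum_congr rfl fun a _ => by ring

theorem expect_mono (p : PMF α) {F G : α → ℝ} (h : ∀ a, F a ≤ G a) :
    expect p F ≤ expect p G :=
  Finset.sum_le_sum fun a _ => mul_le_mul_of_nonneg_left (h a) ENNReal.toReal_nonneg

theorem expect_uniformOfFintype [Nonempty α] (F : α → ℝ) :
    expect (PMF.uniformOfFintype α) F = (Fintype.card α : ℝ)⁻¹ * ∑ a, F a := by
  simp [expect, Finset.mul_sum]

end Expectation

/-- The convex function `-log` lies above its tangent at `P / (1 - w)`, whose slope is `-(1 - w) /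
P`. Tilting the tangent at `P` by `w` costs only `2 * w ^ 2`, from `log (1 - w) ≥ -w - 2 * w ^ 2`.
-/
theorem neg_log_add_log_ge {P Q w : ℝ} (hP : 0 < P) (hQ : 0 < Q) (hw : w ≤ 1 / 2) :
    (1 - w) * ((P - Q) / P) - 2 * w ^ 2 ≤ -Real.log Q + Real.log P := by
  have h1 : 0 < 1 - w := by linarith
  have h2 := Real.log_le_sub_one_of_pos (mul_pos (div_pos hQ hP) h1)
  rw [Real.log_mul (div_pos hQ hP).ne' h1.ne', Real.log_div hQ.ne' hP.ne'] at h2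
  have h3 := Real.one_sub_inv_le_log_of_pos h1
  have h4 : -w - 2 * w ^ 2 ≤ 1 - (1 - w)⁻¹ := by
    have : (1 - w)⁻¹ ≤ 1 + w + 2 * w ^ 2 := by
      rw [inv_le_iff_one_le_mul₀ h1]
      nlinarith [mul_nonneg (sq_nonneg w) (by linarith : 0 ≤ 1 - 2 * w)]
    linarith
  have h5 : (P - Q) / P = 1 - Q / P := by rw [sub_div, div_self hP.ne']
  rw [h5]
  linarith

/-! ### Geometry of the log-barrier and stability of the leader. -/

section Geometry

variable {n : ℕ}

/-- The eigenvector equation paired with `w`. With `w = v` it expresses `l` as the squared local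
norm of `v`; with `w = h - g` it turns a perturbation along `v` into weighted coordinate
differences. -/
theorem sum_hessian_mul {h v : Pt n} {l : ℝ} (hh : h ∈ openSimplex n)
    (hl : hessian barrier h v = l • v) (w : Fin n → ℝ) :
    ∑ i, v i * w i / h i ^ 2 + (∑ k, v k) * (∑ k, w k) / (1 - ∑ k, h k) ^ 2 =
      l * ∑ i, v i * w i := by
  have h1 : ∀ i, v i / h i ^ 2 + (∑ k, v k) / (1 - ∑ k, h k) ^ 2 = l * v i := fun i => by
    rw [← hessian_barrier hh, hl]; rfl
  rw [mul_div_right_comm, Finset.mul_sum, Finset.mul_sum, ← Finset.sum_add_distrib]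
  refine Finset.sum_congr rfl fun i _ => ?_
  rw [← mul_assoc, ← h1]
  ring

theorem sum_sq_eq_one {v : Pt n} (hv : ‖v‖ = 1) : ∑ i, v i * v i = 1 := by
  have := EuclideanSpace.real_norm_sq_eq v
  rw [hv] at this
  simpa [sq] using this.symm

theorem eigenvalue_pos {h v : Pt n} {l : ℝ} (hh : h ∈ openSimplex n) (hv : ‖v‖ = 1)
    (hl : hessian barrier h v = l • v) : 0 < l := by
  have h1 := sum_hessian_mul hh hl v
  have h2 := sum_sq_eq_one hv
  rw [h2, mul_one] at h1
  have h3 : ∃ i, v i ≠ 0 := by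
    by_contra! h0
    simp [h0] at h2
  obtain ⟨i, hi⟩ := h3
  have h4 : 0 < ∑ i, v i * v i / h i ^ 2 :=
    Finset.sum_pos' (fun i _ => div_nonneg (mul_self_nonneg _) (sq_nonneg _))
      ⟨i, Finset.mem_univ i, div_pos (mul_self_pos.2 hi) (pow_pos (hh.1 i) 2)⟩
  have h5 : 0 ≤ (∑ k, v k) * (∑ k, v k) / (1 - ∑ k, h k) ^ 2 :=
    div_nonneg (mul_self_nonneg _) (sq_nonneg _)
  linarith

/-- Stability of the regularized leader: a linear perturbation of local dual norm `|c| ≤ 1 / 2`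
along an eigenvector lowers the optimal value by at most `2 * c ^ 2` more than the perturbation
at the leader. -/
theorem objective_perturb_ge {η : ℝ} {S h g v : Pt n} {l c : ℝ} (hh : h ∈ openSimplex n)
    (hS : ∀ i, η * S i = (h i)⁻¹ - (1 - ∑ k, h k)⁻¹) (hg : g ∈ openSimplex n) (hv : ‖v‖ = 1)
    (hl : hessian barrier h v = l • v) (hc : |c| ≤ 1 / 2) :
    objective η S h + c * Real.sqrt l * inner ℝ h v - 2 * c ^ 2 ≤
      objective η S g + c * Real.sqrt l * inner ℝ g v := by
  have hlpos := eigenvalue_pos hh hv hl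
  have hpos : 0 < 1 - ∑ k, h k := sub_pos.2 hh.2
  have hgpos : 0 < 1 - ∑ k, g k := sub_pos.2 hg.2
  obtain ⟨r, hr⟩ : ∃ r, r = Real.sqrt l := ⟨_, rfl⟩
  have hrpos : 0 < r := hr ▸ Real.sqrt_pos.2 hlpos
  have hrl : r ^ 2 = l := hr ▸ Real.sq_sqrt hlpos.le
  rw [← hr]
  -- The tilts are chosen so that their linear contributions sum to the perturbation along `v`. The
  -- last coordinate has the opposite sign because `lift` moves it by `-∑ k, v k`.
  let w : Fin n → ℝ := fun i => -(c / r) * (v i / h i)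
  let w' : ℝ := (c / r) * ((∑ k, v k) / (1 - ∑ k, h k))
  have hw2 : ∑ i, w i ^ 2 + w' ^ 2 = c ^ 2 := by
    have h1 := sum_hessian_mul hh hl v
    rw [sum_sq_eq_one hv, mul_one] at h1
    calc ∑ i, w i ^ 2 + w' ^ 2 = (c / r) ^ 2 * l := by
          rw [← h1, mul_add, Finset.mul_sum]
          congr 1
          · exact Finset.sum_congr rfl fun i _ => by simp only [w]; ring
          · rw [mul_pow, div_pow (∑ k, v k), sq (∑ k, v k)]
      _ = c ^ 2 := by rw [← hrl]; field_simp
  have hc2 : c ^ 2 ≤ (1 / 2) ^ 2 := sq_le_sq' (by linarith [neg_abs_le c]) ((le_abs_self c).trans hc)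
  have hwi : ∀ i, w i ≤ 1 / 2 := fun i => by
    refine le_of_sq_le_sq ?_ (by norm_num)
    have := Finset.single_le_sum (f := fun i => w i ^ 2) (fun _ _ => sq_nonneg _)
      (Finset.mem_univ i)
    nlinarith [sq_nonneg w']
  have hw' : w' ≤ 1 / 2 := by
    refine le_of_sq_le_sq ?_ (by norm_num)
    have : 0 ≤ ∑ i, w i ^ 2 := Finset.sum_nonneg fun _ _ => sq_nonneg _
    linarith
  have h1 := Finset.sum_le_sum fun i (_ : i ∈ Finset.univ) =>
    neg_log_add_log_ge (hh.1 i) (hg.1 i) (hwi i)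
  have h2 := neg_log_add_log_ge hpos hgpos hw'
  -- The untilted parts give the linear loss difference, by stationarity of `h`.
  have h3 : ∑ i, (h i - g i) / h i + (1 - ∑ k, h k - (1 - ∑ k, g k)) / (1 - ∑ k, h k) =
      η * inner ℝ h S - η * inner ℝ g S := by
    have e : η * inner ℝ h S - η * inner ℝ g S = ∑ i, (η * S i) * (h i - g i) := by
      simp only [PiLp.inner_apply, RCLike.inner_apply, conj_trivial, Finset.mul_sum,
        ← Finset.sum_sub_distrib]
      exact Finset.sum_congr rfl fun i _ => by ring
    rw [e]
    simp only [hS, sub_mul, Finset.sum_sub_distrib, ← Finset.mul_sum]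
    rw [← sub_eq_zero]
    have : ∑ i, (h i - g i) / h i = ∑ i, (h i)⁻¹ * (h i - g i) :=
      Finset.sum_congr rfl fun i _ => by ring
    rw [this]
    ring
  have h4 : ∑ i, w i * ((h i - g i) / h i) +
      w' * ((1 - ∑ k, h k - (1 - ∑ k, g k)) / (1 - ∑ k, h k)) =
      -(c * r * inner ℝ h v - c * r * inner ℝ g v) := by
    have e : c * r * inner ℝ h v - c * r * inner ℝ g v = c * r * ∑ i, v i * (h i - g i) := by
      simp only [PiLp.inner_apply, RCLike.inner_apply, conj_trivial, ← mul_sub,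
        ← Finset.sum_sub_distrib]
    have e2 : c * r * ∑ i, v i * (h i - g i) = (c / r) * (l * ∑ i, v i * (h i - g i)) := by
      rw [← hrl]; field_simp
    rw [e, e2, ← sum_hessian_mul hh hl fun i => h i - g i, mul_add, Finset.mul_sum, neg_add,
      ← Finset.sum_neg_distrib, Finset.sum_sub_distrib]
    congr 1
    · exact Finset.sum_congr rfl fun i _ => by simp only [w]; ring
    · simp only [w']
      generalize ∑ k, h k = H at hpos ⊢
      field_simp
      ring
  simp only [objective, barrier]
  simp only [sub_mul, one_mul, Finset.sum_sub_distrib, Finset.sum_add_distrib,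
    Finset.sum_neg_distrib, ← Finset.mul_sum] at h1 h2
  linarith

theorem differentiableAt_barrier {h : Pt n} (hh : h ∈ openSimplex n) :
    DifferentiableAt ℝ barrier h := by
  have h1 : ∀ i, h i ≠ 0 := fun i => (hh.1 i).ne'
  have h2 : 1 - ∑ k, h k ≠ 0 := (sub_pos.2 hh.2).ne'
  unfold barrier
  refine DifferentiableAt.sub (DifferentiableAt.neg ?_) (DifferentiableAt.log (by fun_prop) h2)
  exact DifferentiableAt.fun_sum fun i _ => DifferentiableAt.log (by fun_prop) (h1 i)

theorem leader_mem (η : ℝ) (S : Pt n) : leader η S ∈ openSimplex n :=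
  (exists_argmin η S).choose_spec.1

theorem leader_isMinOn (η : ℝ) (S : Pt n) :
    IsMinOn (objective η S) (openSimplex n) (leader η S) :=
  (exists_argmin η S).choose_spec.2

theorem leader_stationary (η : ℝ) (S : Pt n) (i : Fin n) :
    η * S i = (leader η S i)⁻¹ - (1 - ∑ k, leader η S k)⁻¹ := by
  set h := leader η S with hdef
  have hh : h ∈ openSimplex n := leader_mem η S
  have hmin : IsLocalMin (objective η S) h :=
    (leader_isMinOn η S).isLocalMin ((isOpen_openSimplex n).mem_nhds hh)
  have hg := (differentiableAt_barrier hh).hasGradientAt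
  rw [gradient_barrier hh, hasGradientAt_iff_hasFDerivAt] at hg
  have hi : HasFDerivAt (fun f : Pt n => η * inner ℝ f S) (η • innerSL ℝ S) h := by
    have := ((innerSL ℝ S).hasFDerivAt (x := h)).const_mul η
    refine this.congr_of_eventuallyEq (Filter.Eventually.of_forall fun f => ?_)
    simp [real_inner_comm]
  have h0 := hmin.hasFDerivAt_eq_zero (hi.add hg)
  have h1 := DFunLike.congr_fun h0 (EuclideanSpace.single i 1)
  simp [EuclideanSpace.inner_single_right] at h1
  linarith

/-- The uniform point is stationary only for the zero loss, hence the condition on round `0`. -/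
theorem center_stationary (η : ℝ) (t : ℕ) (S : Pt n) (h0 : t = 0 → S = 0) (i : Fin n) :
    η * S i = (center η t S i)⁻¹ - (1 - ∑ k, center η t S k)⁻¹ := by
  cases t with
  | zero =>
    have hn : (n : ℝ) + 1 ≠ 0 := by positivity
    have : 1 - n * ((n : ℝ) + 1)⁻¹ = ((n : ℝ) + 1)⁻¹ := by field_simp; ring
    simp [h0 rfl, center, this]
  | succ t => exact leader_stationary η S i

theorem barrier_eq_sum_log_lift (f : Pt n) : barrier f = -∑ j, Real.log (lift f j) := by
  simp [barrier, lift, Fin.sum_univ_castSucc]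
  ring

theorem barrier_uniform :
    barrier (WithLp.toLp 2 (fun _ => 1 / ((n : ℝ) + 1)) : Pt n) =
      ((n : ℝ) + 1) * Real.log ((n : ℝ) + 1) := by
  have hn : (n : ℝ) + 1 ≠ 0 := by positivity
  have : 1 - n * ((n : ℝ) + 1)⁻¹ = ((n : ℝ) + 1)⁻¹ := by field_simp; ring
  simp [barrier, this]
  ring

/-- Eliminating the last arm makes the loss affine on `ℝ^(d-1)`; its constant cancels in
differences. -/
theorem sum_lift_mul (f : Pt n) (y : Fin (n + 1) → ℝ) :
    ∑ j, lift f j * y j =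
      y (Fin.last n) + inner ℝ f (WithLp.toLp 2 fun i => y i.castSucc - y (Fin.last n)) := by
  simp only [lift, Fin.sum_univ_castSucc, Fin.snoc_castSucc, Fin.snoc_last, PiLp.inner_apply,
    RCLike.inner_apply, conj_trivial, sub_mul, Finset.sum_sub_distrib, ← Finset.mul_sum]
  simp only [mul_comm]
  ring

end Geometry

/-! ### Conditional expectations within one round. -/

section Rounds

variable {n : ℕ} (η : ℝ) (x : ℕ → Fin (n + 1) → ℝ) (E : EigenRule n)

theorem expect_roundLaw [NeZero n] (t : ℕ) (past : Fin t → Round n) (F : Round n → ℝ) :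
    expect (roundLaw η x E t past) F =
      (n : ℝ)⁻¹ * ∑ i, (2⁻¹ : ℝ) * (∑ j, lift (play η x E t past i true) j * F (i, true, j) +
        ∑ j, lift (play η x E t past i false) j * F (i, false, j)) := by
  have h1 : ∀ i b (G : Fin (n + 1) → ℝ), expect (armLaw η x E t past i b) G =
      ∑ j, lift (play η x E t past i b) j * G j := fun i b G => by
    simp only [expect, armLaw, PMF.ofFintype_apply,
      ENNReal.toReal_ofReal (lift_play_nonneg η x E t past i b _)]
  simp only [roundLaw, expect_bind, expect_map, expect_uniformOfFintype, h1, Fintype.sum_bool]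
  simp

/-- The loss is affine in the played point, and the two signs put that point symmetrically about the
centre. -/
theorem expect_roundLaw_loss [NeZero n] (t : ℕ) (past : Fin t → Round n) :
    expect (roundLaw η x E t past) (fun r => x t r.2.2) =
      ∑ j, lift (centerAt η x E t past) j * x t j := by
  have hn : (n : ℝ) ≠ 0 := NeZero.ne _
  have h1 : ∀ i, (2⁻¹ : ℝ) * (∑ j, lift (play η x E t past i true) j * x t j +
      ∑ j, lift (play η x E t past i false) j * x t j) =
      ∑ j, lift (centerAt η x E t past) j * x t j := fun i => by
    simp only [sum_lift_mul, play, inner_add_left, inner_smul_left, sgn]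
    simp
    ring
  simp only [expect_roundLaw, h1]
  simp [hn]

/-- The estimate is unbiased for the reduced loss vector up to the factor `d / (d - 1)`. -/
theorem expect_roundLaw_estimate [NeZero n] (t : ℕ) (past : Fin t → Round n) (w : Pt n) :
    expect (roundLaw η x E t past)
        (fun r => inner ℝ w (estimate x E t past (centerAt η x E t past) r)) =
      ((n : ℝ) + 1) / n *
        inner ℝ w (WithLp.toLp 2 fun i => x t i.castSucc - x t (Fin.last n)) := by
  set h := centerAt η x E t past with hdef
  have hh : h ∈ openSimplex n := center_mem _ _ _
  set y : Pt n := WithLp.toLp 2 fun i => x t i.castSucc - x t (Fin.last n) with hy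
  -- Averaging over the sign kills the part of the loss that does not depend on it; in the rest
  -- `λ^(1/2)` cancels `λ^(-1/2)`. The sum over the basis then recovers the inner product, and the
  -- uniform index contributes `1 / n`.
  have h1 : ∀ i, (2⁻¹ : ℝ) * (∑ j, lift (play η x E t past i true) j *
        inner ℝ w (estimate x E t past h (i, true, j)) +
      ∑ j, lift (play η x E t past i false) j *
        inner ℝ w (estimate x E t past h (i, false, j))) =
      ((n : ℝ) + 1) * (inner ℝ w (E.vec t past h i) * inner ℝ (E.vec t past h i) y) := fun i => by
    have hl : 0 < E.val t past h i :=
      eigenvalue_pos hh ((E.vec t past h).norm_eq_one i) (E.eigen t past h hh i)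
    have hr := (Real.sqrt_pos.2 hl).ne'
    have h2 : ∀ b, ∑ j, lift (play η x E t past i b) j *
        inner ℝ w (estimate x E t past h (i, b, j)) =
        ((n : ℝ) + 1) * sgn b * Real.sqrt (E.val t past h i) * inner ℝ w (E.vec t past h i) *
          ∑ j, lift (play η x E t past i b) j * x t j := fun b => by
      rw [Finset.mul_sum]
      refine Finset.sum_congr rfl fun j _ => ?_
      simp only [estimate, inner_smul_right]
      ring
    rw [h2, h2]
    simp only [sum_lift_mul, play, inner_add_left, inner_smul_left, ← hdef, ← hy, sgn]
    simp only [if_true, Bool.false_eq_true, if_false, conj_trivial]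
    field_simp
    ring
  rw [expect_roundLaw]
  simp only [h1]
  rw [← Finset.mul_sum, OrthonormalBasis.sum_inner_mul_inner]
  ring

/-! ### Evolution of the potential. -/

/-- The optimal value of the regularized cumulative estimated loss, with the linear part measured
relative to a comparator `u`. -/
noncomputable def potential (u : Pt n) (t : ℕ) (past : Fin t → Round n) : ℝ :=
  objective η (cumEstimate η x E t past) (centerAt η x E t past) -
    η * inner ℝ u (cumEstimate η x E t past)

theorem potential_le (u : Pt n) (hu : u ∈ openSimplex n) (t : ℕ) (past : Fin (t + 1) → Round n) :
    potential η x E u (t + 1) past ≤ barrier u := by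
  have := leader_isMinOn η (cumEstimate η x E (t + 1) past) hu
  change objective η _ (leader η _) ≤ objective η _ u at this
  rw [potential, centerAt, center]
  simp only [objective] at this ⊢
  linarith

/-- The estimate is a multiple of one eigenvector with coefficient proportional to `λ^(1/2)`, so the
local dual norm of `η x̃_t` is `|η d x_t[j_t]|` whatever the eigenvalue. -/
theorem potential_snoc_ge (u : Pt n) (t : ℕ) (past : Fin t → Round n) (r : Round n)
    (hr : |η * ((n + 1) * x t r.2.2)| ≤ 1 / 2) :
    potential η x E u t past +
        η * inner ℝ (centerAt η x E t past - u)
          (estimate x E t past (centerAt η x E t past) r) -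
        2 * (η * ((n + 1) * x t r.2.2)) ^ 2 ≤
      potential η x E u (t + 1) (Fin.snoc (α := fun _ => Round n) past r) := by
  set h := centerAt η x E t past with hdef
  set S := cumEstimate η x E t past with hSdef
  have hh : h ∈ openSimplex n := center_mem _ _ _
  have hcum : cumEstimate η x E (t + 1) (Fin.snoc (α := fun _ => Round n) past r) =
      S + estimate x E t past h r := by
    simp only [cumEstimate, Fin.init_snoc, Fin.snoc_last]
    rfl
  set g := centerAt η x E (t + 1) (Fin.snoc (α := fun _ => Round n) past r) with hg
  have hgm : g ∈ openSimplex n := center_mem _ _ _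
  have hst : ∀ i, η * S i = (h i)⁻¹ - (1 - ∑ k, h k)⁻¹ :=
    center_stationary η t S (by rintro rfl; rfl)
  have hsg : |sgn r.2.1| = 1 := by cases r.2.1 <;> simp [sgn]
  have hsg2 : sgn r.2.1 ^ 2 = 1 := by rw [← sq_abs, hsg, one_pow]
  have key := objective_perturb_ge (c := η * ((n + 1) * x t r.2.2) * sgn r.2.1) hh hst hgm
    ((E.vec t past h).norm_eq_one r.1) (E.eigen t past h hh r.1)
    (by rwa [abs_mul, hsg, mul_one])
  rw [mul_pow, hsg2, mul_one] at key
  rw [potential, potential, hcum, ← hdef, ← hSdef, ← hg]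
  simp only [objective, estimate, inner_add_right, inner_sub_left, inner_smul_right] at key ⊢
  linarith

/-- The total loss of the first `T` rounds. -/
noncomputable def totalLoss (T : ℕ) (ω : Fin T → Round n) : ℝ := ∑ t : Fin T, x t (ω t).2.2

/-- The one-round inequality telescoped in expectation, from the initial value `d log d`. -/
theorem expect_potential_ge [NeZero n] (hη : 0 < η) {s : ℝ} (u : Pt n) (T : ℕ)
    (hx : ∀ t < T, ∀ j, x t j ∈ Set.Icc 0 s) (hs : η * ((n + 1) * s) ≤ 1 / 2) :
    ((n : ℝ) + 1) * Real.log (n + 1) +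
        η * (((n : ℝ) + 1) / n) *
          (expect (scribleLaw η x E T) (totalLoss x T) -
            ∑ t : Fin T, ∑ j, lift u j * x t j) -
        2 * η ^ 2 * (n + 1) ^ 2 * s * expect (scribleLaw η x E T) (totalLoss x T) ≤
      expect (scribleLaw η x E T) (potential η x E u T) := by
  induction T with
  | zero =>
    have : potential η x E u 0 Fin.elim0 = ((n : ℝ) + 1) * Real.log (n + 1) := by
      simp only [potential, objective, centerAt, center, cumEstimate, inner_zero_right, mul_zero,
        barrier_uniform]
      ring
    simp [scribleLaw, expect_pure, totalLoss, this]
  | succ T ih =>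
    specialize ih fun t ht => hx t (ht.trans T.lt_succ_self)
    have hxT := hx T T.lt_succ_self
    set a : ℝ := ∑ j, lift u j * x T j with ha
    set K : ℝ := ((n : ℝ) + 1) / n with hK
    have hloss : expect (scribleLaw η x E (T + 1)) (totalLoss x (T + 1)) =
        expect (scribleLaw η x E T) (totalLoss x T) +
        expect (scribleLaw η x E T) fun past =>
          expect (roundLaw η x E T past) fun r => x T r.2.2 := by
      rw [scribleLaw, expect_bind, ← expect_add]
      congr 1
      funext past
      rw [expect_map]
      simp only [totalLoss, Fin.sum_univ_castSucc, Fin.snoc_castSucc, Fin.snoc_last, expect_add,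
        expect_const, Fin.val_castSucc, Fin.val_last]
    have hstep : ∀ past, potential η x E u T past +
        (η * K - 2 * η ^ 2 * (n + 1) ^ 2 * s) *
          (expect (roundLaw η x E T past) fun r => x T r.2.2) + -(η * K * a) ≤
        expect (roundLaw η x E T past) fun r =>
          potential η x E u (T + 1) (Fin.snoc (α := fun _ => Round n) past r) := by
      intro past
      have h1 : ∀ r : Round n, potential η x E u T past +
          (η * inner ℝ (centerAt η x E T past - u)
            (estimate x E T past (centerAt η x E T past) r) +
          -(2 * η ^ 2 * (n + 1) ^ 2 * s) * x T r.2.2) ≤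
          potential η x E u (T + 1) (Fin.snoc (α := fun _ => Round n) past r) := fun r => by
        obtain ⟨h0, hs'⟩ := hxT r.2.2
        have hn : (0 : ℝ) < n + 1 := by positivity
        have h2 := potential_snoc_ge η x E u T past r (by
          rw [abs_of_nonneg (by positivity)]
          refine le_trans ?_ hs
          gcongr)
        -- Only one of the two factors `x` is replaced by `s`, which keeps the error proportional to
        -- the loss.
        have h3 : 2 * (η * ((n + 1) * x T r.2.2)) ^ 2 ≤
            2 * η ^ 2 * (n + 1) ^ 2 * s * x T r.2.2 := by
          calc 2 * (η * ((n + 1) * x T r.2.2)) ^ 2 =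
                2 * η ^ 2 * (n + 1) ^ 2 * x T r.2.2 * x T r.2.2 := by ring
            _ ≤ _ := by gcongr
        linarith
      refine le_trans (le_of_eq ?_) (expect_mono _ h1)
      rw [expect_add, expect_add, expect_const, expect_const_mul, expect_const_mul,
        expect_roundLaw_estimate, expect_roundLaw_loss, ha, sum_lift_mul, sum_lift_mul,
        inner_sub_left]
      ring
    have h4 := expect_mono (scribleLaw η x E T) hstep
    rw [expect_add, expect_add, expect_const, expect_const_mul] at h4
    have h5 : expect (scribleLaw η x E (T + 1)) (potential η x E u (T + 1)) =
        expect (scribleLaw η x E T) fun past => expect (roundLaw η x E T past) fun r =>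
          potential η x E u (T + 1) (Fin.snoc (α := fun _ => Round n) past r) := by
      rw [scribleLaw, expect_bind]
      simp only [expect_map]
    rw [h5, hloss, Fin.sum_univ_castSucc]
    simp only [Fin.val_castSucc, Fin.val_last]
    rw [← ha]
    linarith

end Rounds

/-! ### The comparator and the final bound. -/

/-- The mixture of the vertex `j` of the simplex with the uniform distribution. -/
noncomputable def mixture (n : ℕ) (γ : ℝ) (j : Fin (n + 1)) : Pt n :=
  WithLp.toLp 2 fun i => (1 - γ) * (if i.castSucc = j then 1 else 0) + γ / (n + 1)

theorem lift_mixture (n : ℕ) (γ : ℝ) (j k : Fin (n + 1)) :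
    lift (mixture n γ j) k = (1 - γ) * (if k = j then 1 else 0) + γ / (n + 1) := by
  have hn : (n : ℝ) + 1 ≠ 0 := by positivity
  refine Fin.lastCases ?_ (fun i => ?_) k
  · have h1 : ∑ k : Fin (n + 1), (if k = j then (1 : ℝ) else 0) = 1 := by simp
    rw [Fin.sum_univ_castSucc] at h1
    simp only [lift, mixture, Fin.snoc_last, Finset.sum_add_distrib, ← Finset.mul_sum,
      eq_sub_of_add_eq h1, Finset.sum_const, Finset.card_univ, Fintype.card_fin, nsmul_eq_mul]
    field_simp
    ring
  · simp [lift, mixture]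

theorem mem_openSimplex_of_lift_pos {n : ℕ} {f : Pt n} (h : ∀ j, 0 < lift f j) :
    f ∈ openSimplex n := by
  refine ⟨fun i => by simpa [lift] using h i.castSucc, ?_⟩
  simpa [lift] using h (Fin.last n)

end Scrible

theorem mainTheorem5 (n : ℕ) [NeZero n] (T : ℕ) (hT : 1 ≤ T) (s η : ℝ)
    (x : ℕ → Fin (n + 1) → ℝ) (hx : ∀ t < T, ∀ j, x t j ∈ Set.Icc 0 s) (E : EigenRule n)
    (d : ℝ) (hd : d = n + 1) (hη : 0 < η) (hηs : 4 * η * s * d ^ 2 < 1) :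
    ∫ ω, ∑ t : Fin T, x t (ω t).2.2 ∂(scribleLaw η x E T).toMeasure ≤
      1 / (1 - 4 * η * s * d ^ 2) *
        ((⨅ j, ∑ t : Fin T, x t j) + d * η⁻¹ * Real.log (d * T)) := by
  have hint : ∫ ω, ∑ t : Fin T, x t (ω t).2.2 ∂(scribleLaw η x E T).toMeasure =
      expect (scribleLaw η x E T) (totalLoss x T) := by
    rw [PMF.integral_eq_sum]
    rfl
  obtain ⟨j, hj⟩ := exists_eq_ciInf_of_finite (f := fun j => ∑ t : Fin T, x t j)
  have hn1 : (1 : ℝ) ≤ n := by exact_mod_cast NeZero.one_le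
  have hT1 : (1 : ℝ) ≤ T := by exact_mod_cast hT
  have hs0 : 0 ≤ s := (hx 0 hT 0).1.trans (hx 0 hT 0).2
  have hd2 : 2 ≤ d := by linarith
  have hd0 : 0 < d := by linarith
  have hT0 : (0 : ℝ) < T := by linarith
  have hηs0 : 0 ≤ η * s := by positivity
  -- Both bounds come from `4 η s d² < 1` and `d ≥ 2`.
  have hηd : η * (d * s) ≤ 1 / 8 := by nlinarith
  have hηs16 : η * s ≤ 1 / 16 := by nlinarith
  set u := mixture n (1 / T) j with hu
  have hlift : ∀ k, 1 / (d * T) ≤ lift u k := fun k => by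
    rw [hu, lift_mixture, ← hd, div_div, mul_comm d]
    have : 1 / (T : ℝ) ≤ 1 := by rw [div_le_one hT0]; exact hT1
    have h2 : (0 : ℝ) ≤ if k = j then 1 else 0 := by split_ifs <;> norm_num
    nlinarith
  have hmem : u ∈ openSimplex n :=
    mem_openSimplex_of_lift_pos fun k => lt_of_lt_of_le (by positivity) (hlift k)
  have hbar : barrier u ≤ d * Real.log (d * T) := by
    have h1 : ∀ k, -Real.log (d * T) ≤ Real.log (lift u k) := fun k => by
      rw [← Real.log_inv, ← one_div]
      exact Real.log_le_log (by positivity) (hlift k)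
    have h2 := Finset.sum_le_sum fun k (_ : k ∈ Finset.univ) => h1 k
    rw [barrier_eq_sum_log_lift]
    simp only [Finset.sum_const, Finset.card_univ, Fintype.card_fin, nsmul_eq_mul] at h2
    push_cast at h2
    rw [← hd] at h2
    linarith
  have hcomp : ∑ t : Fin T, ∑ k, lift u k * x t k ≤ ∑ t : Fin T, x t j + s := by
    have h1 : ∀ t : Fin T, ∑ k, lift u k * x t k ≤ x t j + 1 / T * s := fun t => by
      have hxt := hx t t.2
      have hsum : ∑ k, x t k ≤ d * s := by
        have := Finset.sum_le_sum fun k (_ : k ∈ Finset.univ) => (hxt k).2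
        simpa [hd] using this
      have e : ∑ k, lift u k * x t k = (1 - 1 / T) * x t j + 1 / T / d * ∑ k, x t k := by
        simp only [hu, lift_mixture, ← hd, add_mul, Finset.sum_add_distrib, mul_assoc,
          ← Finset.mul_sum]
        simp
      have h2 : 1 / T / d * ∑ k, x t k ≤ 1 / T / d * (d * s) := by gcongr
      have h3 : 1 / T / d * (d * s) = 1 / T * s := by field_simp
      have h4 : 0 ≤ 1 / T * x t j := mul_nonneg (by positivity) (hxt j).1
      linarith
    refine (Finset.sum_le_sum fun t _ => h1 t).trans (le_of_eq ?_)
    rw [Finset.sum_add_distrib]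
    simp
    field_simp
  set L := expect (scribleLaw η x E T) (totalLoss x T) with hL
  have hL0 : 0 ≤ L := by
    rw [hL, ← expect_const (scribleLaw η x E T) 0]
    exact expect_mono _ fun ω => Finset.sum_nonneg fun t _ => (hx t t.2 _).1
  have hmain := expect_potential_ge η x E hη u T hx (by rw [← hd]; linarith)
  have hup : expect (scribleLaw η x E T) (potential η x E u T) ≤ d * Real.log (d * T) := by
    rw [← expect_const (scribleLaw η x E T) (d * Real.log (d * T))]
    -- For `T ≥ 1` the final centre is a leader, as `potential_le` needs.
    obtain ⟨m, rfl⟩ := Nat.exists_eq_add_of_le' hT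
    exact expect_mono _ fun ω => (potential_le η x E u hmem m ω).trans hbar
  rw [← hL, ← hd] at hmain
  rw [hint, ← hj, one_div, le_inv_mul_iff₀ (by linarith)]
  rw [Real.log_mul hd0.ne' hT0.ne'] at hup ⊢
  have hlogd : 1 / 2 ≤ Real.log d :=
    (by linarith [Real.log_two_gt_d9] : (1 : ℝ) / 2 ≤ Real.log 2).trans
      (Real.log_le_log (by norm_num) hd2)
  have hlogT : 0 ≤ Real.log T := Real.log_nonneg hT1
  set C := ∑ t : Fin T, ∑ k, lift u k * x t k with hC
  have hn0 : (0 : ℝ) < n := by linarith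
  -- The initial potential `d log d` cancels that part of `d log (dT)`. The term `d η⁻¹ log d` in
  -- the claim is thus left to absorb the mixing cost `s`, in `h5`.
  have h1 : η * (d / n) * (L - C) ≤ d * Real.log T + 2 * η ^ 2 * d ^ 2 * s * L := by linarith
  have h2 : L - C ≤ n / (η * d) * (d * Real.log T + 2 * η ^ 2 * d ^ 2 * s * L) := by
    have := mul_le_mul_of_nonneg_left h1 (by positivity : 0 ≤ n / (η * d))
    have e : n / (η * d) * (η * (d / n) * (L - C)) = L - C := by field_simp
    rwa [e] at this
  have h3 : n / (η * d) * (d * Real.log T + 2 * η ^ 2 * d ^ 2 * s * L) ≤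
      d / (η * d) * (d * Real.log T + 2 * η ^ 2 * d ^ 2 * s * L) := by
    gcongr
    linarith
  have h4 : d / (η * d) * (d * Real.log T + 2 * η ^ 2 * d ^ 2 * s * L) =
      d * η⁻¹ * Real.log T + 2 * η * s * d ^ 2 * L := by field_simp
  have h5 : s ≤ d * η⁻¹ * Real.log d := by
    have : s = η⁻¹ * (η * s) := by field_simp
    rw [this, mul_comm d, mul_assoc]
    exact mul_le_mul_of_nonneg_left (by nlinarith) (by positivity)
  -- The argument yields the constant `2`; nonnegativity of this term relaxes it to the stated `4`.
  have h6 : 0 ≤ η * s * d ^ 2 * L := by positivity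
  linarith
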